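/- Let $\mathrm{Cat}$ be the 2-category of small categories, $\mathrm{CAT}$ that of (possibly large) categories, and $\mathbb{1}$ the terminal category. A \emph{prederivator} is a strict 2-functor $\mathcal{D}\colon \mathrm{Cat}^{\mathrm{op}}\to\mathrm{CAT}$ (contravariant on functors, covariant on natural transformations); write $u^*=\mathcal{D}(u)\colon\mathcal{D}(B)\to\mathcal{D}(A)$ for $u\colon A\to B$. It is a \emph{derivator} if (Der1) for every set-indexed family $(A_i)_{i\in I}$ of small categories the canonical functor $\mathcal{D}(\coprod_i A_i)\to\prod_i\mathcal{D}(A_i)$ is an equivalence; (Der2) a morphism $f$ of $\mathcal{D}(A)$ is an isomorphism if $a^*f$ is an isomorphism in $\mathcal{D}(\mathbb{1})$ for every object $a\colon\mathbb{1}\to A$; (Der3) every $u^*$ has a left adjoint $u_!$ and a right adjoint $u_*$; (Der4) for every $u\colon A\to B$ and every object $b\in B$ the canonical mates $\pi_!\,p^*\to b^*u_!$ of the slice square of $(u/b)$ and $b^*u_*\to\pi_*\,p^*$ of the slice square of $(b/u)$ are isomorphisms, where $p$ is the projection of the slice category to $A$ and $\pi$ its functor to $\mathbb{1}$. A \emph{morphism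 of derivators} $F\colon\mathcal{D}\to\mathcal{E}$ is a pseudo-natural transformation, with components $F_A\colon\mathcal{D}(A)\to\mathcal{E}(A)$ and coherent structure isomorphisms $F_Au^*\cong u^*F_B$. It \emph{preserves left Kan extensions along} $u\colon A\to B$ if the canonical mate $$u_!F_A\xrightarrow{\ \eta\ }u_!F_Au^*u_!\cong u_!u^*F_Bu_!\xrightarrow{\ \varepsilon\ }F_Bu_!$$ is an isomorphism. For a set $S$, seen as a discrete category, $F$ \emph{preserves $S$-fold coproducts} if it preserves left Kan extensions along $S\to\mathbb{1}$. Let $i_S\colon S\to S^{\rhd}$ be the inclusion into the category obtained by adjoining a new terminal object; an object $X\in\mathcal{D}(S^{\rhd})$ is a \emph{coproduct cocone} if it lies in the essential image of $(i_S)_!\colon\mathcal{D}(S)\to\mathcal{D}(S^{\rhd})$. \textbf{Proposition.} Let $F\colon\mathcal{D}\to\mathcal{E}$ be a morphism of derivators and let $S$ be a (possibly empty) discrete category. The following are equivalent. (i) The morphism $F$ preserves $S$-fold coproducts. (ii) The morphism $F$ preserves left Kan extensions along $i_S\colon S\to S^{\rhd}$. (iii) The functor $F_{S^{\rhd}}\colon\mathcal{D}(S^{\rhd})\to\mathcal{E}(S^{\rhd})$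 sends coproduct cocones to coproduct cocones. (iv) The functor $F_{\mathbb{1}}\colon\mathcal{D}(\mathbb{1})\to\mathcal{E}(\mathbb{1})$ preserves $S$-fold coproducts, in the usual sense of category theory. (v) For every small category $A$ the functor $F_A\colon\mathcal{D}(A)\to\mathcal{E}(A)$ preserves $S$-fold coproducts, in the usual sense of category theory. -/

import Mathlib

open CategoryTheory

universe w v u

noncomputable section

set_option linter.checkUnivs false in
/-- A prederivator: a strict `2`-functor `Catᵒᵖ ⥤ CAT`, where `Cat` is the `2`-category of small
categories. The opposite reverses `1`-cells (functors) and keeps the direction of `2`-cells. -/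
abbrev Prederivator : Type _ :=
  StrictPseudofunctor (Cat.{w, w}ᵒᵖ) Cat.{v, u}

/-- The terminal category, as a small category. -/
abbrev TerminalCat : Type w := Discrete PUnit.{w + 1}

/-- The functor `A ⥤ 𝟙`. -/
abbrev toTerminalCat (A : Type w) [SmallCategory A] : A ⥤ TerminalCat.{w} :=
  (Functor.const A).obj ⟨PUnit.unit⟩

/-- The object `a` of `A`, seen as a functor `𝟙 ⥤ A`. -/
abbrev pointFunctor {A : Type w} [SmallCategory A] (a : A) : TerminalCat.{w} ⥤ A :=
  Functor.fromPUnit a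

/-- The tautological transformation `p ⋙ u ⟶ π ⋙ b` on the slice category `(u/b)`. -/
def sliceTrans {A B : Type w} [SmallCategory A] [SmallCategory B] (u : A ⥤ B) (b : B) :
    CostructuredArrow.proj u b ⋙ u ⟶
      toTerminalCat (CostructuredArrow u b) ⋙ pointFunctor b where
  app f := f.hom
  naturality _ _ h := (CostructuredArrow.w h).trans (Category.comp_id _).symm

/-- The tautological transformation `π ⋙ b ⟶ p ⋙ u` on the slice category `(b/u)`. -/
def cosliceTrans {A B : Type w} [SmallCategory A] [SmallCategory B] (u : A ⥤ B) (b : B) :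
    toTerminalCat (StructuredArrow b u) ⋙ pointFunctor b ⟶
      StructuredArrow.proj b u ⋙ u where
  app f := f.hom
  naturality _ _ h := (Category.id_comp _).trans (StructuredArrow.w h).symm

namespace Prederivator

variable (D : Prederivator.{w, v, u})

/-- The value `D(A)`. -/
abbrev val (A : Type w) [SmallCategory A] : Cat.{v, u} :=
  D.obj (Opposite.op (Cat.of A))

section

variable {A B C : Type w} [SmallCategory A] [SmallCategory B] [SmallCategory C]

/-- The restriction functor `u^* : D(B) ⥤ D(A)` of a functor `u : A ⥤ B`. -/
def res (u : A ⥤ B) : D.val B ⥤ D.val A :=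
  (D.map u.toCatHom.op).toFunctor

/-- The natural transformation `α^* : u^* ⟶ v^*` of a natural transformation `α : u ⟶ v`. -/
def resMap {u v : A ⥤ B} (α : u ⟶ v) : D.res u ⟶ D.res v :=
  (D.map₂ (Bicategory.Opposite.op2 α.toCatHom₂)).toNatTrans

/-- The structure isomorphism `(u ⋙ v)^* ≅ v^* ⋙ u^*`; its two sides are in fact equal and it is
the identity of them. -/
def resComp (u : A ⥤ B) (v : B ⥤ C) : D.res (u ⋙ v) ≅ D.res v ⋙ D.res u :=
  Cat.Hom.toNatIso (D.mapComp v.toCatHom.op u.toCatHom.op)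

end

/-- The canonical functor `D(∐ᵢ Aᵢ) ⥤ ∏ᵢ D(Aᵢ)`. -/
def coprodComparison {I : Type w} (A : I → Type w) [∀ i, SmallCategory (A i)] :
    D.val (Σ i, A i) ⥤ ∀ i, D.val (A i) :=
  Functor.pi' fun i => D.res (Sigma.incl i)

/-- (Der3): restriction functors have left adjoints and right adjoints. -/
class HasKanExtensions : Prop where
  isRightAdjoint {A B : Type w} [SmallCategory A] [SmallCategory B] (u : A ⥤ B) :
    (D.res u).IsRightAdjoint
  isLeftAdjoint {A B : Type w} [SmallCategory A] [SmallCategory B] (u : A ⥤ B) :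
    (D.res u).IsLeftAdjoint

attribute [instance] HasKanExtensions.isRightAdjoint HasKanExtensions.isLeftAdjoint

section

variable [D.HasKanExtensions] {A B : Type w} [SmallCategory A] [SmallCategory B]

/-- The left Kan extension functor `u_! : D(A) ⥤ D(B)`. -/
def lan (u : A ⥤ B) : D.val A ⥤ D.val B := (D.res u).leftAdjoint

/-- The adjunction `u_! ⊣ u^*`. -/
def lanAdj (u : A ⥤ B) : D.lan u ⊣ D.res u := Adjunction.ofIsRightAdjoint (D.res u)

/-- The right Kan extension functor `u_* : D(A) ⥤ D(B)`. -/
def ran (u : A ⥤ B) : D.val A ⥤ D.val B := (D.res u).rightAdjoint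

/-- The adjunction `u^* ⊣ u_*`. -/
def ranAdj (u : A ⥤ B) : D.res u ⊣ D.ran u := Adjunction.ofIsLeftAdjoint (D.res u)

/-- The canonical mate `π_! p^* ⟶ b^* u_!` of the slice square of `(u/b)`. -/
def sliceMate (u : A ⥤ B) (b : B) :
    D.res (CostructuredArrow.proj u b) ⋙ D.lan (toTerminalCat (CostructuredArrow u b)) ⟶
      D.lan u ⋙ D.res (pointFunctor b) :=
  ((mateEquiv (D.lanAdj u) (D.lanAdj (toTerminalCat (CostructuredArrow u b)))).symm
    (.mk _ _ _ _ ((D.resComp _ _).inv ≫ D.resMap (sliceTrans u b) ≫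
      (D.resComp _ _).hom))).natTrans

/-- The canonical mate `b^* u_* ⟶ π_* p^*` of the slice square of `(b/u)`. -/
def cosliceMate (u : A ⥤ B) (b : B) :
    D.ran u ⋙ D.res (pointFunctor b) ⟶
      D.res (StructuredArrow.proj b u) ⋙ D.ran (toTerminalCat (StructuredArrow b u)) :=
  (mateEquiv (D.ranAdj u) (D.ranAdj (toTerminalCat (StructuredArrow b u)))
    (.mk _ _ _ _ ((D.resComp _ _).inv ≫ D.resMap (cosliceTrans u b) ≫
      (D.resComp _ _).hom))).natTrans

end

/-- The axioms (Der1) to (Der4) of a derivator. -/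
class IsDerivator : Prop extends D.HasKanExtensions where
  /-- (Der1): coproducts are sent to products (up to equivalence). -/
  isEquivalence_coprodComparison {I : Type w} (A : I → Type w) [∀ i, SmallCategory (A i)] :
    (D.coprodComparison A).IsEquivalence
  /-- (Der2): isomorphisms are detected pointwise. -/
  isIso_of_pointwise {A : Type w} [SmallCategory A] {X Y : D.val A} (f : X ⟶ Y)
    (hf : ∀ a : A, IsIso ((D.res (pointFunctor a)).map f)) : IsIso f
  /-- (Der4), pointwise formula for left Kan extensions. -/
  isIso_sliceMate {A B : Type w} [SmallCategory A] [SmallCategory B] (u : A ⥤ B) (b : B) :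
    IsIso (D.sliceMate u b)
  /-- (Der4), pointwise formula for right Kan extensions. -/
  isIso_cosliceMate {A B : Type w} [SmallCategory A] [SmallCategory B] (u : A ⥤ B) (b : B) :
    IsIso (D.cosliceMate u b)

/-- The inclusion `i_A : A ⥤ A^▷`, where `A^▷` is `A` with a new terminal object. -/
abbrev coconeIncl (A : Type w) [SmallCategory A] : A ⥤ WithTerminal A := WithTerminal.incl

/-- A cocone `X` in `D(A^▷)` is colimiting if it lies in the essential image of `(i_A)_!`.
For a discrete category `A` such an `X` is called a coproduct cocone. -/
def IsColimitingCocone [D.HasKanExtensions] {A : Type w} [SmallCategory A]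
    (X : D.val (WithTerminal A)) : Prop :=
  (D.lan (coconeIncl A)).essImage X

end Prederivator

set_option linter.checkUnivs false in
/-- A derivator. -/
structure Derivator where
  /-- The underlying prederivator. -/
  toPre : Prederivator.{w, v, u}
  [isDerivator : toPre.IsDerivator]

attribute [instance] Derivator.isDerivator

/-- A morphism of derivators: a pseudo-natural transformation of the underlying `2`-functors. -/
abbrev DerivatorHom (D E : Derivator.{w, v, u}) : Type _ :=
  Pseudofunctor.StrongTrans D.toPre.toPseudofunctor E.toPre.toPseudofunctor

namespace DerivatorHom

variable {D E : Derivator.{w, v, u}} (F : DerivatorHom D E)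

/-- The component `F_A : D(A) ⥤ E(A)`. -/
def functor (A : Type w) [SmallCategory A] : D.toPre.val A ⥤ E.toPre.val A :=
  (F.app (Opposite.op (Cat.of A))).toFunctor

section

variable {A B : Type w} [SmallCategory A] [SmallCategory B]

/-- The structure isomorphism `F_A u^* ≅ u^* F_B`. -/
def resIso (u : A ⥤ B) :
    D.toPre.res u ⋙ F.functor A ≅ F.functor B ⋙ E.toPre.res u :=
  Cat.Hom.toNatIso (F.naturality u.toCatHom.op)

/-- The canonical mate `u_! F_A ⟶ u_! F_A u^* u_! ≅ u_! u^* F_B u_! ⟶ F_B u_!`. -/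
def lanMate (u : A ⥤ B) :
    F.functor A ⋙ E.toPre.lan u ⟶ D.toPre.lan u ⋙ F.functor B :=
  ((mateEquiv (D.toPre.lanAdj u) (E.toPre.lanAdj u)).symm
    (.mk _ _ _ _ (F.resIso u).hom)).natTrans

/-- `F` preserves left Kan extensions along `u`. -/
def PreservesLan (u : A ⥤ B) : Prop := IsIso (F.lanMate u)

end

/-- `F` preserves `S`-fold coproducts: it preserves left Kan extensions along the functor
`S ⥤ 𝟙`, where the set `S` is seen as a discrete category. -/
def PreservesCoproducts (S : Type w) : Prop :=
  F.PreservesLan (toTerminalCat (Discrete S))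

end DerivatorHom

end

/-! Mates are traded for universal arrows: `α : X ⟶ u^* Y` is universal when it exhibits `Y` as `u_!
X`. The canonical mate of `F` is invertible exactly when `F` carries universal arrows for `u` to
universal arrows (`preservesLan_iff`). By (Der4) and (Der2), universality can be tested on the
slices `(u/b)` (`isUniversalArrow_iff_sliceArrow`).

(i) ⇔ (ii): the slice of `i_S` over the new terminal object is equivalent to `S`, and those over the
objects of `S` are equivalent to `𝟙`, where there is nothing to preserve. (ii) ⇔ (iii): the unit of
`(i_S)_! ⊣ i_S^*` is invertible, so being a coproduct cocone amounts to universality of any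
isomorphism `X ⟶ i_S^* Y`, and `F` preserves isomorphisms. (i) ⇔ (iv): `S` is equivalent to `∐_S 𝟙`;
(Der1) identifies restriction along the fold functor with the diagonal `D(A) ⥤ ∏_S D(A)`, whose
universal arrows are ordinary coproducts (`isUniversalArrow_fold_iff`). (iv) ⇒ (v): the functors
`a^*` preserve coproducts, being left adjoints, commute with `F`, and jointly detect isomorphisms.
-/

noncomputable section

/-! ### Universal arrows -/

namespace CategoryTheory

universe v₁ v₂ v₃ u₁ u₂ u₃

variable {C : Type u₁} [Category.{v₁} C] {C' : Type u₂} [Category.{v₂} C']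
  {C'' : Type u₃} [Category.{v₃} C'']

/-- A morphism `α : X ⟶ R.obj Y` is a universal arrow from `X` to `R` if every morphism
`X ⟶ R.obj Z` factors uniquely through it. -/
def IsUniversalArrow (R : C' ⥤ C) {X : C} {Y : C'} (α : X ⟶ R.obj Y) : Prop :=
  ∀ Z : C', Function.Bijective fun g : Y ⟶ Z => α ≫ R.map g

lemma Adjunction.isUniversalArrow_unit {L : C ⥤ C'} {R : C' ⥤ C} (adj : L ⊣ R) (X : C) :
    IsUniversalArrow R (adj.unit.app X) := fun Z => by
  have h := (adj.homEquiv X Z).bijective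
  have e : ⇑(adj.homEquiv X Z) = fun g => adj.unit.app X ≫ R.map g := by
    ext g
    exact adj.homEquiv_unit X Z g
  rwa [e] at h

namespace IsUniversalArrow

variable {R : C' ⥤ C} {X X' : C} {Y Y' : C'}

lemma isIso_of_comp {α : X ⟶ R.obj Y} {f : Y ⟶ Y'} (hα : IsUniversalArrow R α)
    (h : IsUniversalArrow R (α ≫ R.map f)) : IsIso f := by
  -- The inverse is the factorization of `α` through the composite arrow.
  obtain ⟨g, hg⟩ := (h Y).2 α
  refine ⟨g, (hα _).1 ?_, (h _).1 ?_⟩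
  · simpa using hg
  · have hg' : (α ≫ R.map f) ≫ R.map g = α := hg
    simp only [Category.assoc] at hg'
    simp only [Functor.map_comp, Category.assoc, Functor.map_id, Category.comp_id]
    rw [reassoc_of% hg']

lemma comp_map {α : X ⟶ R.obj Y} (h : IsUniversalArrow R α) (f : Y ⟶ Y') [IsIso f] :
    IsUniversalArrow R (α ≫ R.map f) := fun Z => by
  have := (h Z).comp (asIso f).homFromEquiv.symm.bijective
  convert this using 1
  ext g
  simp

lemma iff_isIso {α : X ⟶ R.obj Y} {f : Y ⟶ Y'} (hα : IsUniversalArrow R α) :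
    IsUniversalArrow R (α ≫ R.map f) ↔ IsIso f :=
  ⟨hα.isIso_of_comp, fun _ => hα.comp_map f⟩

lemma exists_iso {α : X ⟶ R.obj Y} {β : X ⟶ R.obj Y'} (hα : IsUniversalArrow R α)
    (hβ : IsUniversalArrow R β) : ∃ e : Y ≅ Y', α ≫ R.map e.hom = β := by
  obtain ⟨f, hf⟩ := (hα Y').2 β
  have hf' : α ≫ R.map f = β := hf
  have : IsIso f := hα.isIso_of_comp (by rwa [hf'])
  exact ⟨asIso f, hf'⟩

lemma iso_comp_iff (e : X' ⟶ X) [IsIso e] (α : X ⟶ R.obj Y) :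
    IsUniversalArrow R (e ≫ α) ↔ IsUniversalArrow R α := by
  refine forall_congr' fun Z => ?_
  have : (fun g : Y ⟶ Z => (e ≫ α) ≫ R.map g) =
      (asIso e).symm.homFromEquiv ∘ fun g : Y ⟶ Z => α ≫ R.map g := by
    ext g
    simp
  rw [this]
  exact Equiv.comp_bijective _ _

lemma comp_natIso_iff {R' : C' ⥤ C} (e : R ≅ R') (α : X ⟶ R.obj Y) :
    IsUniversalArrow R' (α ≫ e.hom.app Y) ↔ IsUniversalArrow R α := by
  refine forall_congr' fun Z => ?_
  have : (fun g : Y ⟶ Z => (α ≫ e.hom.app Y) ≫ R'.map g) =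
      (e.app Z).homToEquiv ∘ fun g : Y ⟶ Z => α ≫ R.map g := by
    ext g
    simp
  rw [this]
  exact Equiv.comp_bijective _ _

lemma comp {R' : C'' ⥤ C'} {Z : C''} {α : X ⟶ R.obj Y} {β : Y ⟶ R'.obj Z}
    (hα : IsUniversalArrow R α) (hβ : IsUniversalArrow R' β) :
    IsUniversalArrow (R' ⋙ R) (α ≫ R.map β) := fun W => by
  have h : (fun g : Z ⟶ W => (α ≫ R.map β) ≫ (R' ⋙ R).map g) =
      (fun f => α ≫ R.map f) ∘ fun g => β ≫ R'.map g := by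
    ext g
    simp
  rw [h]
  exact (hα (R'.obj W)).comp (hβ W)

lemma map_iff (G : C ⥤ C'') [G.Full] [G.Faithful] (α : X ⟶ R.obj Y) :
    IsUniversalArrow (R ⋙ G) (Y := Y) (G.map α) ↔ IsUniversalArrow R α := by
  refine forall_congr' fun Z => ?_
  have : (fun g : Y ⟶ Z => G.map α ≫ (R ⋙ G).map g) =
      (Functor.FullyFaithful.ofFullyFaithful G).homEquiv ∘ fun g : Y ⟶ Z => α ≫ R.map g := by
    ext g
    simp
  rw [this]
  exact Equiv.comp_bijective _ _

/-- An isomorphism onto a preimage of `X` is universal because `R` is fully faithful; `α` is that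
arrow followed by some `R.map f`, so both conditions say that `f` is invertible. -/
lemma iff_isIso_of_isEquivalence [R.IsEquivalence] (α : X ⟶ R.obj Y) :
    IsUniversalArrow R α ↔ IsIso α := by
  obtain ⟨f, hf⟩ := R.map_surjective ((R.objObjPreimageIso X).hom ≫ α)
  have h1 : IsUniversalArrow R (R.objObjPreimageIso X).inv := by
    rw [← Category.comp_id (R.objObjPreimageIso X).inv, iso_comp_iff]
    intro Z
    simp only [Category.id_comp]
    exact (Functor.FullyFaithful.ofFullyFaithful R).homEquiv.bijective
  have h2 : α = (R.objObjPreimageIso X).inv ≫ R.map f := by simp [hf]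
  rw [h2, h1.iff_isIso, isIso_comp_left_iff, isIso_iff_of_reflects_iso]

end IsUniversalArrow

end CategoryTheory

/-! ### Restriction functors and the coherence of a morphism -/

namespace Prederivator

variable (D : Prederivator.{w, v, u})
variable {A B C : Type w} [SmallCategory A] [SmallCategory B] [SmallCategory C]

@[simp]
lemma resMap_id (u : A ⥤ B) : D.resMap (𝟙 u) = 𝟙 (D.res u) := by
  have := D.map₂_id u.toCatHom.op
  exact congrArg (fun t => Cat.Hom₂.toNatTrans t) this

lemma resMap_comp {u v w : A ⥤ B} (α : u ⟶ v) (β : v ⟶ w) :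
    D.resMap (α ≫ β) = D.resMap α ≫ D.resMap β := by
  have := D.map₂_comp (Bicategory.Opposite.op2 α.toCatHom₂) (Bicategory.Opposite.op2 β.toCatHom₂)
  exact congrArg (fun t => Cat.Hom₂.toNatTrans t) this

/-- The isomorphism `u^* ≅ v^*` of an isomorphism `u ≅ v`. -/
def resMapIso {u v : A ⥤ B} (α : u ≅ v) : D.res u ≅ D.res v where
  hom := D.resMap α.hom
  inv := D.resMap α.inv
  hom_inv_id := by rw [← resMap_comp, α.hom_inv_id, resMap_id]
  inv_hom_id := by rw [← resMap_comp, α.inv_hom_id, resMap_id]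

/-- The isomorphism `(𝟭)^* ≅ 𝟭`. -/
def resId (A : Type w) [SmallCategory A] : D.res (𝟭 A) ≅ 𝟭 (D.val A) :=
  Cat.Hom.toNatIso (D.mapId (Opposite.op (Cat.of A)))

/-- Restriction along an equivalence is an equivalence. -/
def resEquivalence (e : A ≌ B) : D.val B ≌ D.val A :=
  .mk (D.res e.functor) (D.res e.inverse)
    ((D.resId B).symm ≪≫ D.resMapIso e.counitIso.symm ≪≫ D.resComp e.inverse e.functor)
    ((D.resComp e.functor e.inverse).symm ≪≫ D.resMapIso e.unitIso.symm ≪≫ D.resId A)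

instance isEquivalence_res (u : A ⥤ B) [u.IsEquivalence] : (D.res u).IsEquivalence :=
  (D.resEquivalence u.asEquivalence).isEquivalence_functor

end Prederivator

namespace DerivatorHom

variable {D E : Derivator.{w, v, u}} (F : DerivatorHom D E)
variable {A B C : Type w} [SmallCategory A] [SmallCategory B] [SmallCategory C]

lemma map_resMap_app {u v : A ⥤ B} (θ : u ⟶ v) (Y : D.toPre.val B) :
    (F.functor A).map ((D.toPre.resMap θ).app Y) ≫ (F.resIso v).hom.app Y =
      (F.resIso u).hom.app Y ≫ (E.toPre.resMap θ).app ((F.functor B).obj Y) := by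
  have := F.naturality_naturality (Bicategory.Opposite.op2 θ.toCatHom₂)
  exact congrArg (fun t => (Cat.Hom₂.toNatTrans t).app Y) this

lemma map_resComp_hom_app (u : A ⥤ B) (v : B ⥤ C) (Y : D.toPre.val C) :
    (F.functor A).map ((D.toPre.resComp u v).hom.app Y) ≫
      (F.resIso u).hom.app ((D.toPre.res v).obj Y) ≫
        (E.toPre.res u).map ((F.resIso v).hom.app Y) =
      (F.resIso (u ⋙ v)).hom.app Y ≫ (E.toPre.resComp u v).hom.app ((F.functor C).obj Y) := by
  have := F.naturality_comp v.toCatHom.op u.toCatHom.op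
  have := congrArg (fun t => (Cat.Hom₂.toNatTrans t).app Y) this
  simp [-Pseudofunctor.StrongTrans.naturality_comp] at this
  exact this.symm

lemma map_resId_hom_app (Y : D.toPre.val A) :
    (F.functor A).map ((D.toPre.resId A).hom.app Y) =
      (F.resIso (𝟭 A)).hom.app Y ≫ (E.toPre.resId A).hom.app ((F.functor A).obj Y) := by
  have := F.naturality_id (Opposite.op (Cat.of A))
  have := congrArg (fun t => (Cat.Hom₂.toNatTrans t).app Y) this
  simp [-Pseudofunctor.StrongTrans.naturality_id] at this
  exact this.symm

end DerivatorHom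

/-! ### Universal arrows are pointwise -/

namespace Prederivator

variable (D : Prederivator.{w, v, u})
variable {A B : Type w} [SmallCategory A] [SmallCategory B]

/-- The restriction of an arrow `X ⟶ u^* Y` along the slice square of `(u/b)`. -/
def sliceArrow (u : A ⥤ B) (b : B) {X : D.val A} {Y : D.val B} (α : X ⟶ (D.res u).obj Y) :
    (D.res (CostructuredArrow.proj u b)).obj X ⟶
      (D.res (toTerminalCat (CostructuredArrow u b))).obj ((D.res (pointFunctor b)).obj Y) :=
  (D.res (CostructuredArrow.proj u b)).map α ≫ (D.resComp _ _).inv.app Y ≫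
    (D.resMap (sliceTrans u b)).app Y ≫ (D.resComp _ _).hom.app Y

lemma sliceArrow_comp_map (u : A ⥤ B) (b : B) {X : D.val A} {Y Z : D.val B}
    (α : X ⟶ (D.res u).obj Y) (f : Y ⟶ Z) :
    D.sliceArrow u b (α ≫ (D.res u).map f) =
      D.sliceArrow u b α ≫ (D.res _).map ((D.res (pointFunctor b)).map f) := by
  have h := ((D.resComp (CostructuredArrow.proj u b) u).inv ≫ D.resMap (sliceTrans u b) ≫
    (D.resComp _ _).hom).naturality f
  simp only [NatTrans.comp_app, Functor.comp_map, Category.assoc] at h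
  simp only [sliceArrow, Functor.map_comp, Category.assoc, h]

lemma exists_isUniversalArrow [D.HasKanExtensions] (u : A ⥤ B) (X : D.val A) :
    ∃ (Y : D.val B) (α : X ⟶ (D.res u).obj Y), IsUniversalArrow (D.res u) α :=
  ⟨_, _, (D.lanAdj u).isUniversalArrow_unit X⟩

variable [D.IsDerivator]

/-- By the unit formula for mates, this arrow is the unit of `π_! ⊣ π^*` followed by `π^*` of the
slice mate, which (Der4) makes invertible. -/
lemma isUniversalArrow_sliceArrow_unit (u : A ⥤ B) (b : B) (X : D.val A) :
    IsUniversalArrow (D.res _) (D.sliceArrow u b ((D.lanAdj u).unit.app X)) := by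
  have := IsDerivator.isIso_sliceMate (D := D) u b
  have h := unit_mateEquiv_symm (D.lanAdj u) (D.lanAdj (toTerminalCat (CostructuredArrow u b)))
    (.mk _ _ _ _ ((D.resComp _ _).inv ≫ D.resMap (sliceTrans u b) ≫ (D.resComp _ _).hom)) X
  have h' : D.sliceArrow u b ((D.lanAdj u).unit.app X) =
      (D.lanAdj (toTerminalCat (CostructuredArrow u b))).unit.app _ ≫
        (D.res _).map ((D.sliceMate u b).app X) := h
  rw [h']
  exact ((D.lanAdj _).isUniversalArrow_unit _).comp_map _

/-- Left Kan extensions in a derivator are pointwise. -/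
lemma isUniversalArrow_iff_sliceArrow (u : A ⥤ B) {X : D.val A} {Y : D.val B}
    (α : X ⟶ (D.res u).obj Y) :
    IsUniversalArrow (D.res u) α ↔ ∀ b : B, IsUniversalArrow (D.res _) (D.sliceArrow u b α) := by
  have hη := (D.lanAdj u).isUniversalArrow_unit X
  -- Both sides become invertibility of the comparison `f : u_! X ⟶ Y`, globally or at each point
  -- `b`; (Der2) joins them.
  obtain ⟨f, rfl⟩ := (hη Y).2 α
  simp only [sliceArrow_comp_map, (D.isUniversalArrow_sliceArrow_unit u _ X).iff_isIso]
  rw [hη.iff_isIso]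
  exact ⟨fun _ _ => inferInstance, IsDerivator.isIso_of_pointwise f⟩

end Prederivator

/-! ### Preservation of left Kan extensions -/

namespace DerivatorHom

variable {D E : Derivator.{w, v, u}} (F : DerivatorHom D E)
variable {A B C : Type w} [SmallCategory A] [SmallCategory B] [SmallCategory C]

/-- The image `F X ⟶ F u^* Y ≅ u^* F Y` of an arrow `X ⟶ u^* Y`. -/
def mapArrow (u : A ⥤ B) {X : D.toPre.val A} {Y : D.toPre.val B}
    (α : X ⟶ (D.toPre.res u).obj Y) :
    (F.functor A).obj X ⟶ (E.toPre.res u).obj ((F.functor B).obj Y) :=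
  (F.functor A).map α ≫ (F.resIso u).hom.app Y

lemma resIso_hom_naturality (u : A ⥤ B) {X Y : D.toPre.val B} (f : X ⟶ Y) :
    (F.functor A).map ((D.toPre.res u).map f) ≫ (F.resIso u).hom.app Y =
      (F.resIso u).hom.app X ≫ (E.toPre.res u).map ((F.functor B).map f) :=
  (F.resIso u).hom.naturality f

lemma mapArrow_comp_map (u : A ⥤ B) {X : D.toPre.val A} {Y Z : D.toPre.val B}
    (α : X ⟶ (D.toPre.res u).obj Y) (f : Y ⟶ Z) :
    F.mapArrow u (α ≫ (D.toPre.res u).map f) =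
      F.mapArrow u α ≫ (E.toPre.res u).map ((F.functor B).map f) := by
  simp only [mapArrow, Functor.map_comp, Category.assoc, resIso_hom_naturality]

lemma preservesLan_iff_unit (u : A ⥤ B) :
    F.PreservesLan u ↔ ∀ X : D.toPre.val A, IsUniversalArrow (E.toPre.res u)
      (F.mapArrow u ((D.toPre.lanAdj u).unit.app X)) := by
  have h (X : D.toPre.val A) : F.mapArrow u ((D.toPre.lanAdj u).unit.app X) =
      (E.toPre.lanAdj u).unit.app _ ≫ (E.toPre.res u).map ((F.lanMate u).app X) :=
    unit_mateEquiv_symm (D.toPre.lanAdj u) (E.toPre.lanAdj u) (.mk _ _ _ _ (F.resIso u).hom) X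
  simp only [h, ((E.toPre.lanAdj u).isUniversalArrow_unit _).iff_isIso]
  exact NatTrans.isIso_iff_isIso_app _

lemma preservesLan_iff (u : A ⥤ B) :
    F.PreservesLan u ↔ ∀ ⦃X : D.toPre.val A⦄ ⦃Y : D.toPre.val B⦄ (α : X ⟶ (D.toPre.res u).obj Y),
      IsUniversalArrow (D.toPre.res u) α → IsUniversalArrow (E.toPre.res u) (F.mapArrow u α) := by
  rw [preservesLan_iff_unit]
  refine ⟨fun h X Y α hα => ?_, fun h X => h _ ((D.toPre.lanAdj u).isUniversalArrow_unit X)⟩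
  obtain ⟨e, rfl⟩ := ((D.toPre.lanAdj u).isUniversalArrow_unit X).exists_iso hα
  rw [mapArrow_comp_map]
  exact (h X).comp_map _

/-- One well-chosen universal arrow per object suffices, since universal arrows are unique up to
isomorphism. -/
lemma preservesLan_of_exists (u : A ⥤ B)
    (h : ∀ X : D.toPre.val A, ∃ (Y : D.toPre.val B) (α : X ⟶ (D.toPre.res u).obj Y),
      IsUniversalArrow (D.toPre.res u) α ∧ IsUniversalArrow (E.toPre.res u) (F.mapArrow u α)) :
    F.PreservesLan u := by
  rw [preservesLan_iff_unit]
  intro X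
  obtain ⟨Y, α, hα, hα'⟩ := h X
  obtain ⟨e, he⟩ := hα.exists_iso ((D.toPre.lanAdj u).isUniversalArrow_unit X)
  rw [← he, mapArrow_comp_map]
  exact hα'.comp_map _

lemma preservesLan_of_isEquivalence (u : A ⥤ B) [u.IsEquivalence] : F.PreservesLan u := by
  rw [preservesLan_iff]
  intro X Y α hα
  rw [IsUniversalArrow.iff_isIso_of_isEquivalence] at hα ⊢
  unfold mapArrow
  infer_instance

lemma map_resComp_inv_app (u : A ⥤ B) (v : B ⥤ C) (Y : D.toPre.val C) :
    (F.functor A).map ((D.toPre.resComp u v).inv.app Y) ≫ (F.resIso (u ⋙ v)).hom.app Y =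
      (F.resIso u).hom.app ((D.toPre.res v).obj Y) ≫
        (E.toPre.res u).map ((F.resIso v).hom.app Y) ≫
          (E.toPre.resComp u v).inv.app ((F.functor C).obj Y) := by
  have h := F.map_resComp_hom_app u v Y
  rw [← cancel_mono ((E.toPre.resComp u v).hom.app ((F.functor C).obj Y)), Category.assoc, ← h,
    ← Functor.map_comp_assoc]
  simp

lemma preservesLan_comp (u : A ⥤ B) (v : B ⥤ C) (hu : F.PreservesLan u) (hv : F.PreservesLan v) :
    F.PreservesLan (u ⋙ v) := by
  rw [preservesLan_iff] at hu hv
  refine F.preservesLan_of_exists _ fun X => ?_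
  obtain ⟨Y, α, hα⟩ := D.toPre.exists_isUniversalArrow u X
  obtain ⟨Z, β, hβ⟩ := D.toPre.exists_isUniversalArrow v Y
  refine ⟨_, _, (IsUniversalArrow.comp_natIso_iff (D.toPre.resComp u v).symm _).2 (hα.comp hβ), ?_⟩
  convert (IsUniversalArrow.comp_natIso_iff (E.toPre.resComp u v).symm _).2
    ((hu _ hα).comp (hv _ hβ)) using 1
  simp only [mapArrow, Functor.map_comp, Category.assoc, Iso.symm_hom, map_resComp_inv_app,
    reassoc_of% @resIso_hom_naturality _ _ F]

/-- Pseudo-naturality of `F` makes it commute with restriction along the slice square, up to the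
structure isomorphisms at both ends. -/
lemma map_sliceArrow (u : A ⥤ B) (b : B) {X : D.toPre.val A} {Y : D.toPre.val B}
    (α : X ⟶ (D.toPre.res u).obj Y) :
    F.mapArrow _ (D.toPre.sliceArrow u b α) ≫
        (E.toPre.res _).map ((F.resIso (pointFunctor b)).hom.app Y) =
      (F.resIso (CostructuredArrow.proj u b)).hom.app X ≫
        E.toPre.sliceArrow u b (F.mapArrow u α) := by
  have h4 := F.map_resComp_hom_app (toTerminalCat (CostructuredArrow u b)) (pointFunctor b) Y
  simp only [mapArrow, Prederivator.sliceArrow, Functor.map_comp, Category.assoc, h4,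
    reassoc_of% @map_resMap_app _ _ F,
    reassoc_of% @map_resComp_inv_app _ _ F, reassoc_of% @resIso_hom_naturality _ _ F]

lemma isUniversalArrow_sliceArrow_mapArrow_iff (u : A ⥤ B) (b : B) {X : D.toPre.val A}
    {Y : D.toPre.val B} (α : X ⟶ (D.toPre.res u).obj Y) :
    IsUniversalArrow (E.toPre.res _) (E.toPre.sliceArrow u b (F.mapArrow u α)) ↔
      IsUniversalArrow (E.toPre.res _) (F.mapArrow _ (D.toPre.sliceArrow u b α)) := by
  rw [← IsUniversalArrow.iso_comp_iff ((F.resIso (CostructuredArrow.proj u b)).hom.app X),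
    ← map_sliceArrow]
  refine ⟨fun h => ?_, fun h => h.comp_map _⟩
  simpa [← Functor.map_comp] using h.comp_map (inv ((F.resIso (pointFunctor b)).hom.app Y))

lemma preservesLan_of_slices (u : A ⥤ B)
    (h : ∀ b : B, F.PreservesLan (toTerminalCat (CostructuredArrow u b))) :
    F.PreservesLan u := by
  rw [preservesLan_iff]
  intro X Y α hα
  rw [Prederivator.isUniversalArrow_iff_sliceArrow] at hα ⊢
  intro b
  rw [isUniversalArrow_sliceArrow_mapArrow_iff]
  exact (F.preservesLan_iff _).1 (h b) _ (hα b)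

/-- A partial converse to `preservesLan_of_slices`: when `p` is an equivalence, every object over
the slice is, up to isomorphism, some `p^*` of an object of `D(A)`, and so is reached by a slice
arrow. -/
lemma preservesLan_slice (u : A ⥤ B) (b : B) [(CostructuredArrow.proj u b).IsEquivalence]
    (h : F.PreservesLan u) : F.PreservesLan (toTerminalCat (CostructuredArrow u b)) := by
  refine F.preservesLan_of_exists _ fun X => ?_
  let p := D.toPre.res (CostructuredArrow.proj u b)
  let e : X ≅ p.obj (p.objPreimage X) := (p.objObjPreimageIso X).symm
  have h1 := D.toPre.isUniversalArrow_sliceArrow_unit u b (p.objPreimage X)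
  have h2 := (F.preservesLan_iff_unit u).1 h (p.objPreimage X)
  rw [Prederivator.isUniversalArrow_iff_sliceArrow] at h2
  have h3 := (F.isUniversalArrow_sliceArrow_mapArrow_iff u b _).1 (h2 b)
  refine ⟨_, e.hom ≫ D.toPre.sliceArrow u b _, (IsUniversalArrow.iso_comp_iff _ _).2 h1, ?_⟩
  rw [mapArrow, Functor.map_comp, Category.assoc]
  exact (IsUniversalArrow.iso_comp_iff _ _).2 h3

end DerivatorHom

/-! ### The slices of `S ⥤ S^▷` and coproduct cocones -/

namespace Prederivator

instance isEquivalence_proj_coconeIncl_star (A : Type w) [SmallCategory A] :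
    (CostructuredArrow.proj (coconeIncl A) WithTerminal.star).IsEquivalence where
  full := ⟨fun {X Y} f => ⟨CostructuredArrow.homMk f
    (WithTerminal.starTerminal.hom_ext _ _), rfl⟩⟩
  essSurj := ⟨fun a => ⟨CostructuredArrow.mk (Y := a) (WithTerminal.starTerminal.from _),
    ⟨Iso.refl _⟩⟩⟩

/-- Since `i_S` is full and `S` is discrete, the slice over `s` contains only isomorphisms onto `s`.
-/
lemma exists_hom_eq_map {S : Type w} {s : Discrete S}
    (X : CostructuredArrow (coconeIncl (Discrete S)) ((coconeIncl (Discrete S)).obj s)) :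
    ∃ f : X.left ≅ s, X.hom = (coconeIncl (Discrete S)).map f.hom := by
  obtain ⟨f, hf⟩ := (coconeIncl (Discrete S)).map_surjective (Y := s) X.hom
  exact ⟨asIso f, hf.symm⟩

instance isEquivalence_toTerminalCat_slice {S : Type w} (s : Discrete S) :
    (toTerminalCat (CostructuredArrow (coconeIncl (Discrete S))
      ((coconeIncl (Discrete S)).obj s))).IsEquivalence where
  faithful := ⟨fun {X Y} f g _ => CostructuredArrow.hom_ext _ _ (Subsingleton.elim _ _)⟩
  full := ⟨fun {X Y} _ => by
    obtain ⟨f, hf⟩ := exists_hom_eq_map X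
    obtain ⟨g, hg⟩ := exists_hom_eq_map Y
    exact ⟨CostructuredArrow.homMk (f ≪≫ g.symm).hom (by rw [hf, hg, ← Functor.map_comp]; simp),
      Subsingleton.elim _ _⟩⟩
  essSurj := ⟨fun _ => ⟨CostructuredArrow.mk (Y := s) (𝟙 _), ⟨Iso.refl _⟩⟩⟩

variable (D : Prederivator.{w, v, u})

instance isIso_resMap {A B : Type w} [SmallCategory A] [SmallCategory B] {u v : A ⥤ B}
    (θ : u ⟶ v) [IsIso θ] : IsIso (D.resMap θ) :=
  (D.resMapIso (asIso θ)).isIso_hom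

instance isIso_sliceTrans_coconeIncl {S : Type w} (s : Discrete S) :
    IsIso (sliceTrans (coconeIncl (Discrete S)) ((coconeIncl (Discrete S)).obj s)) := by
  have (X : CostructuredArrow (coconeIncl (Discrete S)) ((coconeIncl (Discrete S)).obj s)) :
      IsIso ((sliceTrans (coconeIncl (Discrete S)) ((coconeIncl (Discrete S)).obj s)).app X) := by
    obtain ⟨f, hf⟩ := exists_hom_eq_map X
    change IsIso X.hom
    rw [hf]
    infer_instance
  exact NatIso.isIso_of_isIso_app _

variable [D.IsDerivator]

/-- The derivator form of the fact that Kan extension along a fully faithful functor has invertible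
unit, checked at each point `s`. -/
lemma isIso_lanAdj_unit_app_coconeIncl {S : Type w} (X : D.val (Discrete S)) :
    IsIso ((D.lanAdj (coconeIncl (Discrete S))).unit.app X) := by
  refine IsDerivator.isIso_of_pointwise _ fun s => ?_
  set α := (D.lanAdj (coconeIncl (Discrete S))).unit.app X
  have h := D.isUniversalArrow_sliceArrow_unit (coconeIncl (Discrete S))
    ((coconeIncl (Discrete S)).obj s) X
  -- Here `π` is an equivalence, so the slice arrow is invertible; all its factors after `p^* α` are
  -- too, hence `p^* α` is.
  rw [IsUniversalArrow.iff_isIso_of_isEquivalence, sliceArrow, isIso_comp_right_iff] at h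
  let t : CostructuredArrow (coconeIncl (Discrete S)) ((coconeIncl (Discrete S)).obj s) :=
    CostructuredArrow.mk (Y := s) (𝟙 _)
  -- The point `s` lifts along `p` to the object `t` of the slice, so `s^* α` is invertible once
  -- `p^* α` is.
  let e : D.res (pointFunctor s) ≅
      D.res (CostructuredArrow.proj (coconeIncl (Discrete S)) ((coconeIncl (Discrete S)).obj s)) ⋙
        D.res (pointFunctor t) :=
    D.resMapIso (Discrete.natIso fun _ => Iso.refl _) ≪≫
      D.resComp (pointFunctor t) (CostructuredArrow.proj _ _)
  rw [NatIso.isIso_map_iff e, Functor.comp_map]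
  infer_instance

lemma isColimitingCocone_iff {S : Type w} {X : D.val (Discrete S)}
    {Y : D.val (WithTerminal (Discrete S))}
    (α : X ⟶ (D.res (coconeIncl (Discrete S))).obj Y) [IsIso α] :
    D.IsColimitingCocone Y ↔ IsUniversalArrow (D.res (coconeIncl (Discrete S))) α := by
  constructor
  · rintro ⟨Z, ⟨e⟩⟩
    have hη := (D.lanAdj (coconeIncl (Discrete S))).isUniversalArrow_unit Z
    have := D.isIso_lanAdj_unit_app_coconeIncl Z
    have h := hη.comp_map e.hom
    -- The universal isomorphism `Z ⟶ i_S^* Y` differs from `α` by the isomorphism `X ≅ Z` inserted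
    -- here.
    rw [← IsUniversalArrow.iso_comp_iff (α ≫ inv ((D.lanAdj _).unit.app Z ≫ (D.res _).map e.hom))]
      at h
    simpa using h
  · intro h
    obtain ⟨e, -⟩ := ((D.lanAdj (coconeIncl (Discrete S))).isUniversalArrow_unit X).exists_iso h
    exact ⟨X, ⟨e⟩⟩

end Prederivator

/-! ### Coproducts as Kan extensions along `S ⥤ S^▷` -/

namespace DerivatorHom

open Prederivator

variable {D E : Derivator.{w, v, u}} (F : DerivatorHom D E)

lemma preservesLan_toTerminalCat_iff {A B : Type w} [SmallCategory A] [SmallCategory B]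
    (u : A ⥤ B) [u.IsEquivalence] :
    F.PreservesLan (toTerminalCat A) ↔ F.PreservesLan (toTerminalCat B) := by
  refine ⟨fun h => ?_, fun h => ?_⟩
  · rw [Functor.punit_ext' (toTerminalCat B) (u.inv ⋙ toTerminalCat A)]
    exact F.preservesLan_comp _ _ (F.preservesLan_of_isEquivalence _) h
  · rw [Functor.punit_ext' (toTerminalCat A) (u ⋙ toTerminalCat B)]
    exact F.preservesLan_comp _ _ (F.preservesLan_of_isEquivalence _) h

lemma preservesCoproducts_iff_preservesLan_coconeIncl (S : Type w) :
    F.PreservesCoproducts S ↔ F.PreservesLan (coconeIncl (Discrete S)) := by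
  have h := F.preservesLan_toTerminalCat_iff
    (CostructuredArrow.proj (coconeIncl (Discrete S)) WithTerminal.star)
  rw [PreservesCoproducts, ← h]
  refine ⟨fun hF => F.preservesLan_of_slices _ fun b => ?_, F.preservesLan_slice _ _⟩
  cases b with
  | star => exact hF
  | of s =>
    exact F.preservesLan_of_isEquivalence (toTerminalCat
      (CostructuredArrow (coconeIncl (Discrete S)) ((coconeIncl (Discrete S)).obj s)))

lemma preservesLan_coconeIncl_iff (S : Type w) :
    F.PreservesLan (coconeIncl (Discrete S)) ↔
      ∀ X : D.toPre.val (WithTerminal (Discrete S)), D.toPre.IsColimitingCocone X →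
        E.toPre.IsColimitingCocone ((F.functor (WithTerminal (Discrete S))).obj X) := by
  have hF {X} {Y : D.toPre.val (WithTerminal (Discrete S))}
      (α : X ⟶ (D.toPre.res (coconeIncl (Discrete S))).obj Y) [IsIso α] :
      IsIso (F.mapArrow _ α) := by
    unfold mapArrow
    infer_instance
  refine ⟨fun h X hX => ?_, fun h => ?_⟩
  · rw [D.toPre.isColimitingCocone_iff (𝟙 _)] at hX
    rw [E.toPre.isColimitingCocone_iff (F.mapArrow _ (𝟙 _))]
    exact (F.preservesLan_iff _).1 h _ hX
  · rw [preservesLan_iff_unit]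
    intro X
    have := D.toPre.isIso_lanAdj_unit_app_coconeIncl X
    have := hF ((D.toPre.lanAdj (coconeIncl (Discrete S))).unit.app X)
    exact (E.toPre.isColimitingCocone_iff _).1 (h _ ⟨_, ⟨Iso.refl _⟩⟩)

end DerivatorHom

/-! ### Ordinary coproducts as universal arrows to the diagonal -/

namespace CategoryTheory

universe v₁ v₂ u₁ u₂

variable {S : Type w} {C : Type u₁} [Category.{v₁} C] {C' : Type u₂} [Category.{v₂} C']

/-- The morphisms `f s : X s ⟶ Y` exhibit `Y` as a coproduct of the family `X`. -/
def IsCoproductFamily {X : S → C} {Y : C} (f : ∀ s, X s ⟶ Y) : Prop :=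
  IsUniversalArrow (Functor.pi' fun _ : S => 𝟭 C) (X := X) (Y := Y) f

lemma isCoproductFamily_iff_isColimit {K : Discrete S ⥤ C} (c : Limits.Cocone K) :
    IsCoproductFamily (fun s : S => c.ι.app ⟨s⟩) ↔ Nonempty (Limits.IsColimit c) := by
  constructor
  · intro h
    choose d hd using fun t : Limits.Cocone K => (h t.pt).2 fun s => t.ι.app ⟨s⟩
    exact ⟨{ desc := d
             fac := fun t ⟨s⟩ => congrFun (hd t) s
             uniq := fun t m hm => (h t.pt).1 ((funext fun s => hm ⟨s⟩).trans (hd t).symm) }⟩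
  · rintro ⟨h⟩ Z
    refine ⟨fun g g' hg => h.hom_ext fun ⟨s⟩ => congrFun hg s, fun f => ?_⟩
    refine ⟨h.desc ⟨Z, Discrete.natTrans fun ⟨s⟩ => f s⟩, funext fun s => ?_⟩
    exact h.fac _ _

lemma preservesColimitsOfShape_discrete_iff (G : C ⥤ C') :
    Limits.PreservesColimitsOfShape (Discrete S) G ↔
      ∀ ⦃X : S → C⦄ ⦃Y : C⦄ (f : ∀ s, X s ⟶ Y), IsCoproductFamily f →
        IsCoproductFamily fun s => G.map (f s) := by
  constructor
  · intro _ X Y f hf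
    obtain ⟨h⟩ := (isCoproductFamily_iff_isColimit (Limits.Cofan.mk Y f)).1 hf
    exact (isCoproductFamily_iff_isColimit (G.mapCocone (Limits.Cofan.mk Y f))).2
      ⟨Limits.isColimitOfPreserves G h⟩
  · exact fun h => ⟨fun {K} => ⟨fun {c} hc => (isCoproductFamily_iff_isColimit (G.mapCocone c)).1
      (h _ ((isCoproductFamily_iff_isColimit c).2 ⟨hc⟩))⟩⟩

namespace IsCoproductFamily

variable {X X' : S → C} {Y Y' : C}

lemma iso_comp_iff (e : ∀ s, X' s ≅ X s) (f : ∀ s, X s ⟶ Y) :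
    IsCoproductFamily (fun s => (e s).hom ≫ f s) ↔ IsCoproductFamily f :=
  IsUniversalArrow.iso_comp_iff (R := Functor.pi' fun _ : S => 𝟭 C) (Pi.isoMk e).hom f

lemma comp {f : ∀ s, X s ⟶ Y} (hf : IsCoproductFamily f) (g : Y ⟶ Y') [IsIso g] :
    IsCoproductFamily fun s => f s ≫ g :=
  IsUniversalArrow.comp_map hf g

lemma isIso_of_comp {f : ∀ s, X s ⟶ Y} (hf : IsCoproductFamily f) {g : Y ⟶ Y'}
    (h : IsCoproductFamily fun s => f s ≫ g) : IsIso g :=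
  IsUniversalArrow.isIso_of_comp hf h

lemma exists_fac {f : ∀ s, X s ⟶ Y} (hf : IsCoproductFamily f) (f' : ∀ s, X s ⟶ Y') :
    ∃ g, ∀ s, f s ≫ g = f' s := by
  obtain ⟨g, hg⟩ := (hf _).2 f'
  exact ⟨g, fun s => congrFun hg s⟩

lemma map_natIso {G G' : C ⥤ C'} (e : G ≅ G') {f : ∀ s, X s ⟶ Y}
    (h : IsCoproductFamily fun s => G.map (f s)) : IsCoproductFamily fun s => G'.map (f s) := by
  rw [← iso_comp_iff fun s => e.app (X s)]
  simpa using h.comp (e.hom.app Y)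

end IsCoproductFamily

end CategoryTheory

/-! ### The fold functor and coproducts in `D(A)` -/

namespace Prederivator

/-- The fold functor `∐_S A ⥤ A`. -/
abbrev foldFunctor (S A : Type w) [SmallCategory A] : (Σ _ : S, A) ⥤ A :=
  Sigma.desc fun _ => 𝟭 A

variable (D : Prederivator.{w, v, u}) {S A : Type w} [SmallCategory A]

/-- The inclusion of a summand followed by the fold functor restricts to the identity. -/
def resFoldIso (s : S) :
    D.res (foldFunctor S A) ⋙ D.res (Sigma.incl (C := fun _ : S => A) s) ≅ 𝟭 (D.val A) :=
  (D.resComp (Sigma.incl (C := fun _ : S => A) s) (foldFunctor S A)).symm ≪≫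
    D.resMapIso (Sigma.inclDesc _ s) ≪≫ D.resId A

/-- The restriction of an arrow `X ⟶ ∇^* Y` to a summand. -/
def summandArrow {X : D.val (Σ _ : S, A)} {Y : D.val A}
    (α : X ⟶ (D.res (foldFunctor S A)).obj Y) (s : S) :
    (D.res (Sigma.incl (C := fun _ : S => A) s)).obj X ⟶ Y :=
  (D.res (Sigma.incl (C := fun _ : S => A) s)).map α ≫ (D.resFoldIso s).hom.app Y

/-- Restriction along the fold functor corresponds to the diagonal functor. -/
def resFoldCompComparisonIso (S A : Type w) [SmallCategory A] :
    D.res (foldFunctor S A) ⋙ D.coprodComparison (fun _ : S => A) ≅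
      Functor.pi' fun _ : S => 𝟭 (D.val A) :=
  NatIso.ofComponents (fun Y => Pi.isoMk fun s => (D.resFoldIso s).app Y) fun f =>
    funext fun s => (D.resFoldIso s).hom.naturality f

variable [D.IsDerivator]

lemma isUniversalArrow_fold_iff {X : D.val (Σ _ : S, A)} {Y : D.val A}
    (α : X ⟶ (D.res (foldFunctor S A)).obj Y) :
    IsUniversalArrow (D.res (foldFunctor S A)) α ↔ IsCoproductFamily (D.summandArrow α) := by
  have := IsDerivator.isEquivalence_coprodComparison (D := D) fun _ : S => A
  rw [← IsUniversalArrow.map_iff (D.coprodComparison fun _ : S => A) α,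
    ← IsUniversalArrow.comp_natIso_iff (D.resFoldCompComparisonIso S A)]
  rfl

lemma exists_iso_summands (X : S → D.val A) : ∃ X' : D.val (Σ _ : S, A),
    Nonempty (∀ s, (D.res (Sigma.incl (C := fun _ : S => A) s)).obj X' ≅ X s) := by
  have := IsDerivator.isEquivalence_coprodComparison (D := D) fun _ : S => A
  let e := (D.coprodComparison fun _ : S => A).objObjPreimageIso X
  exact ⟨_, ⟨fun s => (Pi.eval _ s).mapIso e⟩⟩

/-- Fullness of the comparison functor of (Der1) glues the summands. -/
lemma exists_summandArrow {X : D.val (Σ _ : S, A)} {Y : D.val A}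
    (f : ∀ s, (D.res (Sigma.incl (C := fun _ : S => A) s)).obj X ⟶ Y) :
    ∃ α : X ⟶ (D.res (foldFunctor S A)).obj Y, D.summandArrow α = f := by
  have := IsDerivator.isEquivalence_coprodComparison (D := D) fun _ : S => A
  obtain ⟨α, hα⟩ := (D.coprodComparison fun _ : S => A).map_surjective
    (X := X) (Y := (D.res (foldFunctor S A)).obj Y)
    (fun s => f s ≫ (D.resFoldIso s).inv.app Y)
  refine ⟨α, funext fun s => ?_⟩
  have h : (D.res (Sigma.incl (C := fun _ : S => A) s)).map α = f s ≫ (D.resFoldIso s).inv.app Y :=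
    congrFun hα s
  rw [summandArrow, h]
  simp

lemma exists_isCoproductFamily (X : S → D.val A) :
    ∃ (Y : D.val A) (f : ∀ s, X s ⟶ Y), IsCoproductFamily f := by
  obtain ⟨X', ⟨e⟩⟩ := D.exists_iso_summands X
  obtain ⟨Y, α, hα⟩ := D.exists_isUniversalArrow (foldFunctor S A) X'
  rw [isUniversalArrow_fold_iff] at hα
  exact ⟨Y, _, (IsCoproductFamily.iso_comp_iff (fun s => (e s).symm) _).2 hα⟩

end Prederivator

/-! ### Preservation of coproducts in each `D(A)` -/

namespace DerivatorHom

open Prederivator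

variable {D E : Derivator.{w, v, u}} (F : DerivatorHom D E) {S A : Type w} [SmallCategory A]

lemma map_resFoldIso_hom_app (Y : D.toPre.val A) (s : S) :
    (F.functor A).map ((D.toPre.resFoldIso s).hom.app Y) =
      (F.resIso (Sigma.incl s)).hom.app ((D.toPre.res (foldFunctor S A)).obj Y) ≫
        (E.toPre.res (Sigma.incl s)).map ((F.resIso (foldFunctor S A)).hom.app Y) ≫
          (E.toPre.resFoldIso s).hom.app ((F.functor A).obj Y) := by
  simp only [resFoldIso, resMapIso, Iso.trans_hom, Iso.symm_hom, NatTrans.comp_app,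
    Functor.map_comp, map_resId_hom_app, reassoc_of% @map_resMap_app _ _ F,
    reassoc_of% @map_resComp_inv_app _ _ F]

lemma map_summandArrow {X : D.toPre.val (Σ _ : S, A)} {Y : D.toPre.val A}
    (α : X ⟶ (D.toPre.res (foldFunctor S A)).obj Y) (s : S) :
    (F.functor A).map (D.toPre.summandArrow α s) =
      (F.resIso (Sigma.incl s)).hom.app X ≫ E.toPre.summandArrow (F.mapArrow _ α) s := by
  simp only [summandArrow, mapArrow, Functor.map_comp, map_resFoldIso_hom_app, Category.assoc,
    reassoc_of% @resIso_hom_naturality _ _ F]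

lemma isUniversalArrow_mapArrow_fold_iff {X : D.toPre.val (Σ _ : S, A)} {Y : D.toPre.val A}
    (α : X ⟶ (D.toPre.res (foldFunctor S A)).obj Y) :
    IsUniversalArrow (E.toPre.res (foldFunctor S A)) (F.mapArrow _ α) ↔
      IsCoproductFamily fun s => (F.functor A).map (D.toPre.summandArrow α s) := by
  rw [isUniversalArrow_fold_iff, ← IsCoproductFamily.iso_comp_iff fun s =>
    (F.resIso (Sigma.incl (C := fun _ : S => A) s)).app X]
  simp only [map_summandArrow, Iso.app_hom]

lemma preservesLan_fold_iff (S A : Type w) [SmallCategory A] :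
    F.PreservesLan (foldFunctor S A) ↔
      Limits.PreservesColimitsOfShape (Discrete S) (F.functor A) := by
  rw [preservesColimitsOfShape_discrete_iff, preservesLan_iff]
  constructor
  · intro h X Y f hf
    -- By (Der1), every family in `D(A)` and its maps to `Y` come, up to isomorphism, from one arrow
    -- `X' ⟶ ∇^* Y`.
    obtain ⟨X', ⟨e⟩⟩ := D.toPre.exists_iso_summands X
    obtain ⟨α, hα⟩ := D.toPre.exists_summandArrow fun s => (e s).hom ≫ f s
    rw [← IsCoproductFamily.iso_comp_iff e, ← hα, ← isUniversalArrow_fold_iff] at hf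
    have h' := (F.isUniversalArrow_mapArrow_fold_iff α).1 (h α hf)
    rw [← IsCoproductFamily.iso_comp_iff fun s => (F.functor A).mapIso (e s)]
    simpa [hα] using h'
  · intro h X Y α hα
    rw [isUniversalArrow_fold_iff] at hα
    exact (F.isUniversalArrow_mapArrow_fold_iff α).2 (h _ hα)

lemma preservesCoproducts_iff_preservesColimitsOfShape (S : Type w) :
    F.PreservesCoproducts S ↔
      Limits.PreservesColimitsOfShape (Discrete S) (F.functor TerminalCat.{w}) := by
  -- The equivalence of `S` with `∐_S 𝟙`, whose fold functor is its functor to `𝟙`.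
  let u : Discrete S ⥤ Σ _ : S, TerminalCat.{w} := Discrete.functor fun s => ⟨s, ⟨PUnit.unit⟩⟩
  have : u.IsEquivalence :=
    { faithful := ⟨fun _ => Subsingleton.elim _ _⟩
      full := ⟨by
        rintro ⟨s⟩ ⟨t⟩ ⟨f⟩
        exact ⟨𝟙 _, by simp; rfl⟩⟩
      essSurj := ⟨by
        rintro ⟨s, ⟨⟨⟩⟩⟩
        exact ⟨⟨s⟩, ⟨Iso.refl _⟩⟩⟩ }
  rw [← preservesLan_fold_iff, PreservesCoproducts, F.preservesLan_toTerminalCat_iff u,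
    Functor.punit_ext' (toTerminalCat _) (foldFunctor S TerminalCat.{w})]

lemma preservesColimitsOfShape_of_terminalCat (S A : Type w) [SmallCategory A]
    (h : Limits.PreservesColimitsOfShape (Discrete S) (F.functor TerminalCat.{w})) :
    Limits.PreservesColimitsOfShape (Discrete S) (F.functor A) := by
  rw [preservesColimitsOfShape_discrete_iff] at h ⊢
  intro X Y f hf
  -- `Z` is a coproduct of the images computed in `E(A)`, and `k` compares it with the image of `Y`;
  -- at each `a`, invertibility of `k` reduces to the case of `𝟙`.
  obtain ⟨Z, g, hg⟩ := E.toPre.exists_isCoproductFamily fun s => (F.functor A).obj (X s)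
  obtain ⟨k, hk⟩ := hg.exists_fac fun s => (F.functor A).map (f s)
  -- The right adjoint `a_*` of (Der3) is what makes `a^*` preserve coproducts.
  have hres (D : Prederivator.{w, v, u}) [D.IsDerivator] (a : A) :=
    (preservesColimitsOfShape_discrete_iff (S := S) (D.res (pointFunctor a))).1
      (have : Limits.PreservesColimitsOfSize.{w, w} (D.res (pointFunctor a)) :=
        (D.ranAdj (pointFunctor a)).leftAdjoint_preservesColimits
       inferInstance)
  have : IsIso k := IsDerivator.isIso_of_pointwise k fun a => by
    refine (hres E.toPre a g hg).isIso_of_comp ?_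
    simp only [← Functor.map_comp, hk]
    exact IsCoproductFamily.map_natIso (F.resIso (pointFunctor a)) (h _ (hres D.toPre a f hf))
  simpa only [hk] using hg.comp k

end DerivatorHom

end

theorem mainTheorem7 (D E : Derivator.{w, v, u}) (F : DerivatorHom D E) (S : Type w) :
    List.TFAE [
      F.PreservesCoproducts S,
      F.PreservesLan (Prederivator.coconeIncl (Discrete S)),
      ∀ X : D.toPre.val (WithTerminal (Discrete S)), D.toPre.IsColimitingCocone X →
        E.toPre.IsColimitingCocone ((F.functor (WithTerminal (Discrete S))).obj X),
      Limits.PreservesColimitsOfShape (Discrete S) (F.functor TerminalCat.{w}),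
      ∀ (A : Type w) [SmallCategory A],
        Limits.PreservesColimitsOfShape (Discrete S) (F.functor A)] := by
  tfae_have 1 ↔ 2 := F.preservesCoproducts_iff_preservesLan_coconeIncl S
  tfae_have 2 ↔ 3 := F.preservesLan_coconeIncl_iff S
  tfae_have 1 ↔ 4 := F.preservesCoproducts_iff_preservesColimitsOfShape S
  tfae_have 4 → 5 := fun h A _ => F.preservesColimitsOfShape_of_terminalCat S A h
  tfae_have 5 → 4 := fun h => h TerminalCat.{w}
  tfae_finish
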